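/- Let $X$ be an arbitrary (finite or infinite) set of variables and $\mathcal{R}=\mathbb{C}[[X]]$ the ring of formal power series in $X$. A family $\{G_s\}_{s\in S}$ in $\mathcal{R}$ is called summable if for every monomial the coefficient of that monomial in $G_s$ is zero for all but finitely many $s$. Let $S\subseteq X$, let $\boldsymbol\phi=\{\phi_x\}_{x\in S}$ be a summable family in $\mathcal{R}$, and let $\mathscr{D}^{\boldsymbol\phi}=\sum_{x\in S}\phi_x\,\partial_x$ be the associated derivation of $\mathcal{R}$. For $x\in X$ put $$F_x(t)=e^{t\mathscr{D}^{\boldsymbol\phi}}x=\sum_{n\ge 0}(\mathscr{D}^{\boldsymbol\phi})^n x\,\frac{t^n}{n!}\in\mathcal{R}[[t]]=\mathbb{C}[[X,t]].$$ For $F(t)=\sum_{n\ge0} f_n\frac{t^n}{n!}\in\mathcal{R}[[t]]$ write $F[U]:=f_{|U|}$ for a finite set $U$, and let $$\mathcal{A}_F[n]=\sum_T\prod_{v=1}^n F[T^{-1}(v)]$$ be the inventory of $F$-enriched trees on $n$ vertices, where $T$ runs over all rooted trees with vertex set $[n]=\{1,\dots,n\}$ and $T^{-1}(v)$ is the set of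 children of $v$ in $T$. Let $\mathcal{A}_F(t)=\sum_{n\ge 0}\mathcal{A}_F[n]\frac{t^n}{n!}$. Then the family $\{F_x(t)\}_{x\in X}$ can be substituted for the variables in every series in $\mathcal{R}$ (it is summable in $\mathbb{C}[[X,t]]$ with zero constant terms), and for every $H\in\mathcal{R}$, with $F(t)=H(F_x(t))_{x\in X}$, the series $\mathcal{A}_F(t)$ is the unique solution in $\mathcal{R}[[t]]$ of $\mathcal{A}_F(t)=tF(\mathcal{A}_F(t))$, and $$\mathcal{A}_{H(F_x(t))_{x\in X}}[n]=(\mathscr{D}^{\boldsymbol\phi})^{n-1}\bigl(H(X)^n\bigr)\qquad\text{for all } n\ge 1.$$ In particular, for every $x\in X$, the series $\mathcal{A}_{F_x(t)}(t)$ is the unique solution of $A(t)=tF_x(A(t))$, and $$\mathcal{A}_{F_x(t)}[n]=(\mathscr{D}^{\boldsymbol\phi})^{n-1}x^n\qquad\text{for all } n\ge 1.$$ -/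

import Mathlib

noncomputable section

namespace EnrichedTree

/-! ### Rooted trees and their enrichment -/

/-- A rooted tree on the vertex set `V`, with its edges oriented towards the root: every vertex
other than the root has exactly one outgoing edge, ending at its parent, and following these edges
one reaches the root from every vertex. (By convention the root is recorded as its own parent.) -/
@[ext]
structure RootedTree (V : Type*) where
  root : V
  parent : V → V
  parent_root : parent root = root
  reaches_root : ∀ v, ∃ k : ℕ, parent^[k] v = root

instance RootedTree.instFintype (V : Type*) [Fintype V] : Fintype (RootedTree V) := by
  classical
  exact Fintype.ofInjective (fun T : RootedTree V => (T.root, T.parent)) (fun T U h =>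
    RootedTree.ext (congrArg Prod.fst h) (congrArg Prod.snd h))

/-- The fiber `T⁻¹(v)`: the set of immediate predecessors (children) of `v`. -/
def RootedTree.fiber {V : Type*} (T : RootedTree V) (v : V) : Set V :=
  {u | u ≠ T.root ∧ T.parent u = v}

/-- The coefficient `F[n]` of `t ^ n / n!` in the series `F(t)`. -/
def egfCoeff {R : Type*} [CommRing R] (F : PowerSeries R) (n : ℕ) : R :=
  n.factorial • PowerSeries.coeff n F

/-- `𝒜_F[n]`, the inventory of the `F`-enriched rooted trees with vertex set `[n]`: the sum over
all rooted trees `T` on `n` labelled vertices of the product over the vertices `v` of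
`F[T⁻¹(v)]`, where `F[U] := F[|U|]`. -/
def inventory {R : Type*} [CommRing R] (F : PowerSeries R) (n : ℕ) : R :=
  ∑ T : RootedTree (Fin n), ∏ v, egfCoeff F (T.fiber v).ncard

/-- `𝒜_F(t) = ∑ₙ 𝒜_F[n] tⁿ / n!`. -/
def treeSeries {R : Type*} [CommRing R] [Algebra ℚ R] (F : PowerSeries R) : PowerSeries R :=
  PowerSeries.mk fun n => (n.factorial : ℚ)⁻¹ • inventory F n

/-! ### Derivations of `ℂ⟦X⟧` and one-parameter groups -/

variable {X : Type*}

/-- A family of series is summable if every monomial occurs in only finitely many members. -/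
def IsSummable {S : Type*} (G : S → MvPowerSeries X ℂ) : Prop :=
  ∀ k : X →₀ ℕ, {s | MvPowerSeries.coeff k (G s) ≠ 0}.Finite

/-- `𝒟^φ H = ∑_{x ∈ S} φ_x ∂H/∂x`, the sum being taken coefficient by coefficient
(for a summable family `φ` each of these sums has finitely many nonzero terms). -/
def derivOp {S : Set X} (φ : S → MvPowerSeries X ℂ) (H : MvPowerSeries X ℂ) :
    MvPowerSeries X ℂ :=
  fun k => ∑ᶠ x : S, MvPowerSeries.coeff k (φ x * MvPowerSeries.pderiv ℂ (x : X) H)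

/-- `e^{t𝒟^φ} H = ∑ₙ (𝒟^φ)ⁿ H tⁿ / n!`, an element of `ℂ⟦X⟧⟦t⟧`. -/
def expDerivOp {S : Set X} (φ : S → MvPowerSeries X ℂ) (H : MvPowerSeries X ℂ) :
    PowerSeries (MvPowerSeries X ℂ) :=
  PowerSeries.mk fun n => (n.factorial : ℂ)⁻¹ • (derivOp φ)^[n] H

/-- `F_x(t) = e^{t𝒟^φ} x`. -/
def flow {S : Set X} (φ : S → MvPowerSeries X ℂ) (x : X) : PowerSeries (MvPowerSeries X ℂ) :=
  expDerivOp φ (MvPowerSeries.X x)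

/-- `F_x(t)`, read as an element of `ℂ⟦X, t⟧ = ℂ⟦X⟧⟦t⟧`; the variable `t` is `none`. -/
def flowMv {S : Set X} (φ : S → MvPowerSeries X ℂ) (x : X) : MvPowerSeries (Option X) ℂ :=
  (MvPowerSeries.optionEquivLeft X ℂ).symm (flow φ x)

/-- `H(F_x(t))_{x ∈ X}`, the substitution in `H` of the series `F_x(t)` for the variables `x`,
performed in `ℂ⟦X, t⟧` and read in `ℂ⟦X⟧⟦t⟧`. -/
def substFlow {S : Set X} (φ : S → MvPowerSeries X ℂ) (H : MvPowerSeries X ℂ) :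
    PowerSeries (MvPowerSeries X ℂ) :=
  MvPowerSeries.optionEquivLeft X ℂ (MvPowerSeries.subst (flowMv φ) H)

end EnrichedTree

end

/-! Two independent facts combine. The first is `inventory_succ`: for every series `F`, 𝒜_F[n+1] =
n! [tⁿ] F^(n+1). The second is that e^{t𝒟} is an algebra homomorphism which coincides with
substitution of the F_x(t) (`substFlow_eq_expDerivOp`). Hence F = H(F_x(t)) satisfies Fⁿ =
e^{t𝒟}(Hⁿ), and the coefficient of t^(n-1)/(n-1)! is 𝒟^(n-1)(Hⁿ).

The tree count and the implicit equation both rest on one recursion, c(r, n) = ∑_{k+l=n} [tᵏ]Fʳ ·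
c(k, l) with c(0, n) = δ_{n,0}, which determines c (`eq_forestCoeff`). It is satisfied by r/(n+r)
[tⁿ]F^(n+r) (`forestCoeff_eq_sum`), by [tⁿ]F(A)ʳ for any solution of A = tF(A) (Lagrange inversion),
and, up to n!, by the weighted count of forests with r prescribed roots, on splitting off the
children of the roots (`forestWeight_eq_sum_powerset`). The case r = 1 links trees with the solution
A.

For infinite X, coefficientwise finiteness replaces continuity: each coefficient of 𝒟ⁿf depends on
finitely many coefficients of f. -/

noncomputable section

namespace EnrichedTree

open Finset

/-! ### Lagrange inversion through a two-index recursion. -/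

section Lagrange

variable {R : Type*} [CommRing R]

theorem coeff_X_mul_derivative (F : PowerSeries R) (n : ℕ) :
    PowerSeries.coeff n (PowerSeries.X * PowerSeries.derivative R F) =
      n * PowerSeries.coeff n F := by
  cases n with
  | zero => simp
  | succ n =>
    rw [PowerSeries.coeff_succ_X_mul, PowerSeries.coeff_derivative]
    push_cast
    ring

theorem add_mul_derivative_pow_mul_pow (F : PowerSeries R) (r n : ℕ) :
    ((n + r : ℕ) : PowerSeries R) * (PowerSeries.derivative R (F ^ r) * F ^ n) =
      r * PowerSeries.derivative R (F ^ (n + r)) := by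
  cases r with
  | zero => simp
  | succ r =>
    simp only [Derivation.leibniz_pow, smul_eq_mul, nsmul_eq_mul, Nat.add_sub_cancel,
      ← Nat.add_assoc]
    ring

theorem coeff_pow_eq_zero_of_lt {A : PowerSeries R} (hA : PowerSeries.constantCoeff A = 0)
    {n d : ℕ} (h : n < d) : PowerSeries.coeff n (A ^ d) = 0 :=
  PowerSeries.X_pow_dvd_iff.mp (pow_dvd_pow_of_dvd (PowerSeries.X_dvd_iff.mpr hA) d) n h

theorem coeff_subst_eq_sum {A : PowerSeries R} (hA : PowerSeries.constantCoeff A = 0)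
    (F : PowerSeries R) (n : ℕ) :
    PowerSeries.coeff n (PowerSeries.subst A F : PowerSeries R) =
      ∑ d ∈ range (n + 1), PowerSeries.coeff d F * PowerSeries.coeff n (A ^ d) := by
  rw [PowerSeries.coeff_subst' (PowerSeries.HasSubst.of_constantCoeff_zero' hA)]
  rw [finsum_eq_sum_of_support_subset]
  · rfl
  · intro d hd
    by_contra h
    refine hd ?_
    simp only [coe_range, Set.mem_Iio] at h
    simp only [coeff_pow_eq_zero_of_lt hA (show n < d by omega), smul_zero]

theorem constantCoeff_eq_zero_of_eq_X_mul {A G : PowerSeries R} (h : A = PowerSeries.X * G) :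
    PowerSeries.constantCoeff A = 0 := by
  rw [h]; simp

/-- If tⁿ⁺¹ divides A - B, it divides every A^d - B^d. Consequently A ↦ tF(A) gains one correct
coefficient at each application. -/
theorem coeff_subst_congr {A B : PowerSeries R} (hA : PowerSeries.constantCoeff A = 0)
    (hB : PowerSeries.constantCoeff B = 0) (F : PowerSeries R) {n : ℕ}
    (h : ∀ m ≤ n, PowerSeries.coeff m A = PowerSeries.coeff m B) :
    PowerSeries.coeff n (PowerSeries.subst A F : PowerSeries R) =
      PowerSeries.coeff n (PowerSeries.subst B F : PowerSeries R) := by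
  rw [coeff_subst_eq_sum hA, coeff_subst_eq_sum hB]
  refine sum_congr rfl fun d _ => ?_
  congr 1
  have h1 : (PowerSeries.X : PowerSeries R) ^ (n + 1) ∣ A - B := by
    rw [PowerSeries.X_pow_dvd_iff]
    intro m hm
    rw [map_sub, h m (by omega), sub_self]
  have h2 := PowerSeries.X_pow_dvd_iff.mp (h1.trans (sub_dvd_pow_sub_pow A B d)) n (by omega)
  rwa [map_sub, sub_eq_zero] at h2

/-- Fixed-point iteration from 0: the coefficient of tⁿ no longer changes from the n-th iterate on,
so the diagonal coefficients form the limit. -/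
theorem exists_eq_X_mul_subst (F : PowerSeries R) :
    ∃ A : PowerSeries R, A = PowerSeries.X * PowerSeries.subst A F := by
  set step : PowerSeries R → PowerSeries R :=
    fun A => PowerSeries.X * (PowerSeries.subst A F : PowerSeries R) with hstep
  set a : ℕ → PowerSeries R := fun k => step^[k] 0 with ha
  have ha0 : ∀ k, PowerSeries.constantCoeff (a k) = 0 := by
    rintro (_ | k)
    · simp [ha]
    · simp only [ha, Function.iterate_succ_apply', hstep]
      simp
  have hsucc : ∀ k, a (k + 1) = PowerSeries.X * PowerSeries.subst (a k) F := fun k => by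
    simp only [ha, Function.iterate_succ_apply', hstep]
  have hstab : ∀ k, ∀ n ≤ k, PowerSeries.coeff n (a k) = PowerSeries.coeff n (a (k + 1)) := by
    intro k
    induction k with
    | zero =>
      intro n hn
      obtain rfl : n = 0 := by omega
      simp [ha0]
    | succ k ih =>
      rintro (_ | n) hn
      · simp [ha0]
      · rw [hsucc k, hsucc (k + 1), PowerSeries.coeff_succ_X_mul, PowerSeries.coeff_succ_X_mul]
        exact coeff_subst_congr (ha0 _) (ha0 _) F fun m hm => ih m (by omega)
  have hstab' : ∀ n k, n ≤ k → PowerSeries.coeff n (a k) = PowerSeries.coeff n (a n) := by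
    intro n k hk
    induction k, hk using Nat.le_induction with
    | base => rfl
    | succ k hk ih => rw [← hstab k n hk, ih]
  have hlim : ∀ n k, n ≤ k →
      PowerSeries.coeff n (PowerSeries.mk fun n => PowerSeries.coeff n (a n)) =
        PowerSeries.coeff n (a k) := fun n k hk => by
    rw [PowerSeries.coeff_mk, hstab' n k hk]
  have hlim0 : PowerSeries.constantCoeff
      (PowerSeries.mk fun n => PowerSeries.coeff n (a n)) = 0 := by
    rw [← PowerSeries.coeff_zero_eq_constantCoeff_apply, hlim 0 0 le_rfl]
    simp [ha0]
  refine ⟨PowerSeries.mk fun n => PowerSeries.coeff n (a n), ?_⟩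
  ext n
  cases n with
  | zero => simp [ha0]
  | succ n =>
    rw [hlim (n + 1) (n + 1) le_rfl, hsucc, PowerSeries.coeff_succ_X_mul,
      PowerSeries.coeff_succ_X_mul]
    exact coeff_subst_congr (ha0 _) hlim0 F fun m hm => (hlim m n hm).symm

variable [Algebra ℚ R]

/-- The number `r / (n + r) [tⁿ] F ^ (n + r)`: the coefficient of `tⁿ / n!` in the exponential
generating function of the `F`-enriched rooted forests with `r` prescribed roots. -/
def forestCoeff (F : PowerSeries R) (r n : ℕ) : R :=
  -- At r = n = 0 the fraction would be 0/0, evaluated as 0, while the empty forest must count 1.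
  if r = 0 then (if n = 0 then 1 else 0)
  else ((r : ℚ) / (n + r)) • PowerSeries.coeff n (F ^ (n + r))

theorem forestCoeff_zero_left (F : PowerSeries R) (n : ℕ) :
    forestCoeff F 0 n = if n = 0 then 1 else 0 := by
  simp [forestCoeff]

/-- For n ≥ 1 the sum is 1/n times [tⁿ] of t(Fʳ)′Fⁿ, since k + l = n turns k/(l+k) into k/n. As
(n+r)(Fʳ)′Fⁿ = r(F^(n+r))′, this is a multiple of [tⁿ]F^(n+r). -/
theorem forestCoeff_eq_sum (F : PowerSeries R) (r n : ℕ) :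
    forestCoeff F r n =
      ∑ p ∈ antidiagonal n, PowerSeries.coeff p.1 (F ^ r) * forestCoeff F p.1 p.2 := by
  rcases Nat.eq_zero_or_pos n with rfl | hn
  · rcases Nat.eq_zero_or_pos r with rfl | hr
    · simp [forestCoeff]
    · have : (r : ℚ) ≠ 0 := by positivity
      simp [forestCoeff, hr.ne', this]
  · have hn' : (n : ℚ) ≠ 0 := by positivity
    have hterm : ∀ p ∈ antidiagonal n,
        PowerSeries.coeff p.1 (F ^ r) * forestCoeff F p.1 p.2 =
          (n : ℚ)⁻¹ • (PowerSeries.coeff p.1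
            (PowerSeries.X * PowerSeries.derivative R (F ^ r)) * PowerSeries.coeff p.2 (F ^ n)) := by
      rintro ⟨k, l⟩ hkl
      rw [HasAntidiagonal.mem_antidiagonal] at hkl
      simp only at hkl ⊢
      rw [coeff_X_mul_derivative]
      rcases Nat.eq_zero_or_pos k with rfl | hk
      · have : l ≠ 0 := by omega
        simp [forestCoeff, this]
      · subst hkl
        have : forestCoeff F k l = ((l + k : ℕ) : ℚ)⁻¹ • ((k : R) * PowerSeries.coeff l (F ^ (l + k))) := by
          rw [forestCoeff, if_neg hk.ne', div_eq_inv_mul, mul_smul, Nat.cast_add,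
            Nat.cast_smul_eq_nsmul, nsmul_eq_mul]
        rw [this, Nat.add_comm k l, mul_smul_comm]
        congr 1
        ring
    rw [sum_congr rfl hterm, ← smul_sum, ← PowerSeries.coeff_mul]
    have hr' : ((n + r : ℕ) : ℚ) ≠ 0 := by positivity
    have key : ((n + r : ℕ) : R) * PowerSeries.coeff n
        (PowerSeries.X * PowerSeries.derivative R (F ^ r) * F ^ n) =
        r * (n * PowerSeries.coeff n (F ^ (n + r))) := by
      have h := congrArg (fun G => PowerSeries.coeff n (PowerSeries.X * G))
        (add_mul_derivative_pow_mul_pow F r n)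
      simp only [← nsmul_eq_mul, mul_smul_comm, map_nsmul] at h
      rw [← nsmul_eq_mul, ← nsmul_eq_mul, ← coeff_X_mul_derivative, mul_assoc]
      exact h
    have key' : PowerSeries.coeff n (PowerSeries.X * PowerSeries.derivative R (F ^ r) * F ^ n) =
        ((n + r : ℕ) : ℚ)⁻¹ • ((r : R) * (n * PowerSeries.coeff n (F ^ (n + r)))) := by
      rw [← key, ← nsmul_eq_mul, ← Nat.cast_smul_eq_nsmul ℚ, inv_smul_smul₀ hr']
    rw [key', forestCoeff]
    split_ifs with h0 h1
    · omega
    · simp [h0]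
    · rw [← nsmul_eq_mul, ← nsmul_eq_mul, ← Nat.cast_smul_eq_nsmul ℚ, ← Nat.cast_smul_eq_nsmul ℚ,
        smul_smul, smul_smul, smul_smul]
      congr 1
      push_cast at hr' ⊢
      field_simp

/-- Terms with k ≥ 1 have l < n, so induction on n for all r at once applies; the term k = 0 is the
boundary condition. -/
theorem eq_forestCoeff {F : PowerSeries R} {c : ℕ → ℕ → R}
    (h0 : ∀ n, c 0 n = if n = 0 then 1 else 0)
    (hc : ∀ r n, c r n = ∑ p ∈ antidiagonal n, PowerSeries.coeff p.1 (F ^ r) * c p.1 p.2)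
    (r n : ℕ) : c r n = forestCoeff F r n := by
  induction n using Nat.strong_induction_on generalizing r with
  | _ n ih =>
    rw [hc, forestCoeff_eq_sum]
    refine sum_congr rfl ?_
    rintro ⟨k, l⟩ hkl
    rw [HasAntidiagonal.mem_antidiagonal] at hkl
    simp only at hkl ⊢
    rcases Nat.eq_zero_or_pos k with rfl | hk
    · rw [h0, forestCoeff_zero_left]
    · rw [ih l (by omega)]

/-- The Lagrange inversion formula for the powers of `A / t = F(A)`. -/
theorem coeff_subst_pow_eq_forestCoeff {F A : PowerSeries R}
    (h : A = PowerSeries.X * PowerSeries.subst A F) (r n : ℕ) :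
    PowerSeries.coeff n ((PowerSeries.subst A F : PowerSeries R) ^ r) = forestCoeff F r n := by
  have hA := constantCoeff_eq_zero_of_eq_X_mul h
  have hs := PowerSeries.HasSubst.of_constantCoeff_zero' hA
  refine eq_forestCoeff
    (c := fun r n => PowerSeries.coeff n ((PowerSeries.subst A F : PowerSeries R) ^ r)) ?_ ?_ r n
  · intro n
    simp [PowerSeries.coeff_one]
  · intro r n
    rw [← PowerSeries.subst_pow hs, coeff_subst_eq_sum hA, Nat.sum_antidiagonal_eq_sum_range_succ
      (fun k l => PowerSeries.coeff k (F ^ r) *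
        PowerSeries.coeff l ((PowerSeries.subst A F : PowerSeries R) ^ k))]
    refine sum_congr rfl fun k hk => ?_
    rw [mem_range] at hk
    congr 1
    -- Aᵏ = tᵏF(A)ᵏ, so the coefficient of tⁿ becomes that of t^(n-k) in F(A)ᵏ.
    conv_lhs => rw [h, mul_pow]
    rw [PowerSeries.coeff_X_pow_mul', if_pos (by omega)]

end Lagrange

/-! ### Weighted enumeration of forests with prescribed roots. -/

section Forests

variable {V : Type*} [Fintype V] [DecidableEq V]

/-- The functions `U → R`, extended to `V` by the identity. -/
def attachments (U R : Finset V) : Finset (V → V) :=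
  Fintype.piFinset fun v => if v ∈ U then R else {v}

theorem mem_attachments {U R : Finset V} {q : V → V} :
    q ∈ attachments U R ↔ (∀ v ∈ U, q v ∈ R) ∧ ∀ v ∉ U, q v = v := by
  rw [attachments, Fintype.mem_piFinset]
  constructor
  · intro h
    exact ⟨fun v hv => by simpa [hv] using h v, fun v hv => by simpa [hv] using h v⟩
  · rintro ⟨h1, h2⟩ v
    by_cases hv : v ∈ U
    · simpa [hv] using h1 v hv
    · simpa [hv] using h2 v hv

open Classical in
/-- The parent functions of the rooted forests on `R ∪ N` with set of roots `R`, extended to `V`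
by the identity. -/
def forests (R N : Finset V) : Finset (V → V) :=
  {p ∈ attachments N (R ∪ N) | ∀ v ∈ N, ∃ k : ℕ, p^[k] v ∈ R}

theorem mem_forests {R N : Finset V} {p : V → V} :
    p ∈ forests R N ↔ ((∀ v ∈ N, p v ∈ R ∪ N) ∧ ∀ v ∉ N, p v = v) ∧
      ∀ v ∈ N, ∃ k : ℕ, p^[k] v ∈ R := by
  classical
  rw [forests, mem_filter, mem_attachments]

theorem forests_empty_left_of_nonempty {N : Finset V} (hN : N.Nonempty) : forests ∅ N = ∅ := by
  refine eq_empty_of_forall_notMem fun p hp => ?_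
  obtain ⟨v, hv⟩ := hN
  obtain ⟨k, hk⟩ := (mem_forests.mp hp).2 v hv
  exact notMem_empty _ hk

theorem forests_empty_right (R : Finset V) : forests R ∅ = {id} := by
  ext p
  simp only [mem_forests, notMem_empty, false_imp_iff, implies_true, true_and, and_true,
    not_false_eq_true, true_imp_iff, mem_singleton, funext_iff, id]

variable {A : Type*} [CommRing A]

theorem egfCoeff_zero (F : PowerSeries A) : egfCoeff F 0 = PowerSeries.constantCoeff F := by
  simp [egfCoeff]

theorem egfCoeff_succ (F : PowerSeries A) (n : ℕ) :
    egfCoeff F (n + 1) = egfCoeff (PowerSeries.derivative A F) n := by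
  simp only [egfCoeff, PowerSeries.coeff_derivative, nsmul_eq_mul, Nat.factorial_succ]
  push_cast
  ring

theorem egfCoeff_sum {ι : Type*} (s : Finset ι) (F : ι → PowerSeries A) (n : ℕ) :
    egfCoeff (∑ i ∈ s, F i) n = ∑ i ∈ s, egfCoeff (F i) n := by
  simp only [egfCoeff, map_sum, smul_sum]

/-- The `Function.update` form keeps each summand a product of a family of series over `R`, as the
induction in `sum_attachments` requires. -/
theorem derivative_prod {V : Type*} [DecidableEq V] (R : Finset V) (G : V → PowerSeries A) :
    PowerSeries.derivative A (∏ w ∈ R, G w) =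
      ∑ u ∈ R, ∏ w ∈ R, Function.update G u (PowerSeries.derivative A (G u)) w := by
  induction R using Finset.induction_on with
  | empty => simp
  | insert a R ha ih =>
    have h1 : ∏ w ∈ R, Function.update G a (PowerSeries.derivative A (G a)) w = ∏ w ∈ R, G w :=
      prod_congr rfl fun w hw => Function.update_of_ne (ne_of_mem_of_not_mem hw ha) _ _
    have h2 : ∀ u ∈ R,
        ∏ w ∈ insert a R, Function.update G u (PowerSeries.derivative A (G u)) w =
          G a * ∏ w ∈ R, Function.update G u (PowerSeries.derivative A (G u)) w := fun u hu => by
      rw [prod_insert ha, Function.update_of_ne (ne_of_mem_of_not_mem hu ha).symm]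
    rw [prod_insert ha, Derivation.leibniz, sum_insert ha, prod_insert ha, h1,
      Function.update_self, sum_congr rfl h2, ← mul_sum, ih, smul_eq_mul, smul_eq_mul]
    ring

/-- The enriched functions from `U` to `R` are counted by the product of the series. -/
theorem sum_attachments (U R : Finset V) (G : V → PowerSeries A) :
    ∑ q ∈ attachments U R, ∏ w ∈ R, egfCoeff (G w) #{v ∈ U | q v = w} =
      egfCoeff (∏ w ∈ R, G w) #U := by
  induction U using Finset.induction_on generalizing G with
  | empty =>
    have : attachments ∅ R = {id} := by
      ext q
      simp only [mem_attachments, notMem_empty, false_imp_iff, implies_true, true_and,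
        not_false_eq_true, true_imp_iff, mem_singleton, funext_iff, id]
    simp [this, egfCoeff_zero]
  | insert u U hu ih =>
    rw [card_insert_of_notMem hu, egfCoeff_succ, derivative_prod, egfCoeff_sum]
    simp only [← ih]
    rw [← sum_product']
    symm
    -- Splitting off the image of `u`; resetting `u` to itself respects the convention that
    -- attachments are the identity off their domain.
    refine sum_nbij' (fun x => Function.update x.2 u x.1) (fun q => (q u, Function.update q u u))
      ?_ ?_ ?_ ?_ ?_
    · rintro ⟨w, q⟩ h
      obtain ⟨hw, hq⟩ := mem_product.mp h
      rw [mem_attachments] at hq ⊢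
      refine ⟨fun v hv => ?_, fun v hv => ?_⟩
      · rcases eq_or_ne v u with rfl | hvu
        · simpa using hw
        · simpa [hvu] using hq.1 v (mem_of_mem_insert_of_ne hv hvu)
      · rw [mem_insert, not_or] at hv
        simpa [hv.1] using hq.2 v hv.2
    · intro q hq
      rw [mem_attachments] at hq
      refine mem_product.mpr ⟨hq.1 u (mem_insert_self _ _), mem_attachments.mpr
        ⟨fun v hv => ?_, fun v hv => ?_⟩⟩
      · have hvu : v ≠ u := fun h => hu (h ▸ hv)
        simpa [hvu] using hq.1 v (mem_insert_of_mem hv)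
      · rcases eq_or_ne v u with rfl | hvu
        · simp
        · simpa [hvu] using hq.2 v (by simp [hvu, hv])
    · rintro ⟨w, q⟩ h
      have hq : q u = u := (mem_attachments.mp (mem_product.mp h).2).2 u hu
      simp only [Function.update_self, Function.update_idem, Prod.mk.injEq, true_and]
      conv_rhs => rw [← Function.update_eq_self u q, hq]
    · intro q hq
      simp
    · rintro ⟨w, q⟩ h
      refine prod_congr rfl fun x _ => ?_
      simp only
      have hU : ({v ∈ U | Function.update q u w v = x} : Finset V) = {v ∈ U | q v = x} :=
        filter_congr fun v hv => by rw [Function.update_of_ne (ne_of_mem_of_not_mem hv hu)]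
      rw [filter_insert, Function.update_self, hU]
      rcases eq_or_ne x w with rfl | hxw
      · rw [if_pos rfl, card_insert_of_notMem (by simp [hu]), Function.update_self, egfCoeff_succ]
      · rw [if_neg hxw.symm, Function.update_of_ne hxw]

/-- The weight of a forest: the product of the `f d` over its vertices, `d` being the number of
children. -/
def forestWeight (f : ℕ → A) (R N : Finset V) : A :=
  ∑ p ∈ forests R N, ∏ w ∈ R ∪ N, f #{v ∈ N | p v = w}

/-- The decomposition of a parent function into its restrictions to `U` and to the complement. -/
theorem piecewise_id_piecewise {V : Type*} [DecidableEq V] {U : Finset V} (p : V → V) :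
    U.piecewise (U.piecewise p id) (U.piecewise id p) = p := by
  ext v
  by_cases hv : v ∈ U <;> simp [hv]

theorem restrict_mem_forests {R N : Finset V} {p : V → V} (hRN : Disjoint R N)
    (hp : p ∈ forests R N) :
    ({v ∈ N | p v ∈ R} : Finset V).piecewise id p ∈
      forests {v ∈ N | p v ∈ R} (N \ {v ∈ N | p v ∈ R}) := by
  set U : Finset V := {v ∈ N | p v ∈ R} with hU
  obtain ⟨⟨h1, h2⟩, h3⟩ := mem_forests.mp hp
  have hmem : ∀ v ∈ N, v ∉ U → p v ∈ N := fun v hv hvU => by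
    rcases mem_union.mp (h1 v hv) with h | h
    · exact absurd (by simp [hU, hv, h]) hvU
    · exact h
  refine mem_forests.mpr ⟨⟨fun v hv => ?_, fun v hv => ?_⟩, ?_⟩
  · obtain ⟨hvN, hvU⟩ := mem_sdiff.mp hv
    rw [piecewise_eq_of_notMem _ _ _ hvU, union_sdiff_of_subset (filter_subset _ _)]
    exact hmem v hvN hvU
  · by_cases hvU : v ∈ U
    · simp [hvU]
    · rw [piecewise_eq_of_notMem _ _ _ hvU]
      exact h2 v fun h => hv (mem_sdiff.mpr ⟨h, hvU⟩)
  -- Outside `U` a path stays in `N` and the restricted map agrees with `p`; the last vertex before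
  -- entering `R` lies in `U`.
  · have key : ∀ k v, v ∈ N → p^[k] v ∈ R → ∃ j : ℕ, (U.piecewise id p)^[j] v ∈ U := by
      intro k
      induction k with
      | zero => intro v hv hvR; exact absurd hv (disjoint_left.mp hRN hvR)
      | succ k ih =>
        intro v hv hvR
        by_cases hvU : v ∈ U
        · exact ⟨0, hvU⟩
        · rw [Function.iterate_succ_apply] at hvR
          obtain ⟨j, hj⟩ := ih (p v) (hmem v hv hvU) hvR
          refine ⟨j + 1, ?_⟩
          rwa [Function.iterate_succ_apply, piecewise_eq_of_notMem _ _ _ hvU]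
    intro v hv
    obtain ⟨k, hk⟩ := h3 v (mem_sdiff.mp hv).1
    exact key k v (mem_sdiff.mp hv).1 hk

theorem filter_piecewise {R N U : Finset V} {q p : V → V} (hRN : Disjoint R N) (hU : U ⊆ N)
    (hq : q ∈ attachments U R) (hp : p ∈ forests U (N \ U)) :
    ({v ∈ N | U.piecewise q p v ∈ R} : Finset V) = U := by
  obtain ⟨⟨h1, -⟩, -⟩ := mem_forests.mp hp
  ext v
  rw [mem_filter]
  constructor
  · rintro ⟨hv, hvR⟩
    by_contra hvU
    rw [piecewise_eq_of_notMem _ _ _ hvU] at hvR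
    have := h1 v (mem_sdiff.mpr ⟨hv, hvU⟩)
    rw [union_sdiff_of_subset hU] at this
    exact disjoint_left.mp hRN hvR this
  · intro hv
    rw [piecewise_eq_of_mem _ _ _ hv]
    exact ⟨hU hv, (mem_attachments.mp hq).1 v hv⟩

/-- The glued map follows `p` until the first visit to `U`, whence `q` leads into `R` in one step.
-/
theorem piecewise_mem_forests {R N U : Finset V} {q p : V → V} (hU : U ⊆ N)
    (hq : q ∈ attachments U R) (hp : p ∈ forests U (N \ U)) :
    U.piecewise q p ∈ forests R N := by
  obtain ⟨⟨h1, h2⟩, h3⟩ := mem_forests.mp hp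
  obtain ⟨hq1, -⟩ := mem_attachments.mp hq
  rw [union_sdiff_of_subset hU] at h1
  refine mem_forests.mpr ⟨⟨fun v hv => ?_, fun v hv => ?_⟩, ?_⟩
  · by_cases hvU : v ∈ U
    · rw [piecewise_eq_of_mem _ _ _ hvU]
      exact mem_union_left _ (hq1 v hvU)
    · rw [piecewise_eq_of_notMem _ _ _ hvU]
      exact mem_union_right _ (h1 v (mem_sdiff.mpr ⟨hv, hvU⟩))
  · have hvU : v ∉ U := fun h => hv (hU h)
    rw [piecewise_eq_of_notMem _ _ _ hvU]
    exact h2 v fun h => hv (mem_sdiff.mp h).1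
  · have hmem : ∀ v ∈ U, ∃ k : ℕ, (U.piecewise q p)^[k] v ∈ R := fun v hv => by
      refine ⟨1, ?_⟩
      rw [Function.iterate_one, piecewise_eq_of_mem _ _ _ hv]
      exact hq1 v hv
    have key : ∀ k v, p^[k] v ∈ U → ∃ j : ℕ, (U.piecewise q p)^[j] v ∈ R := by
      intro k
      induction k with
      | zero => exact fun v hv => hmem v hv
      | succ k ih =>
        intro v hv
        by_cases hvU : v ∈ U
        · exact hmem v hvU
        · rw [Function.iterate_succ_apply] at hv
          obtain ⟨j, hj⟩ := ih (p v) hv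
          refine ⟨j + 1, ?_⟩
          rwa [Function.iterate_succ_apply, piecewise_eq_of_notMem _ _ _ hvU]
    intro v hv
    by_cases hvU : v ∈ U
    · exact hmem v hvU
    · obtain ⟨k, hk⟩ := h3 v (mem_sdiff.mpr ⟨hv, hvU⟩)
      exact key k v hk

theorem prod_piecewise_children {R N U : Finset V} {q p : V → V} (f : ℕ → A)
    (hRN : Disjoint R N) (hU : U ⊆ N)
    (hq : q ∈ attachments U R) (hp : p ∈ forests U (N \ U)) :
    ∏ w ∈ R ∪ N, f #{v ∈ N | U.piecewise q p v = w} =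
      (∏ w ∈ R, f #{v ∈ U | q v = w}) * ∏ w ∈ U ∪ (N \ U), f #{v ∈ N \ U | p v = w} := by
  have hfil : ∀ v ∈ N, (U.piecewise q p v ∈ R ↔ v ∈ U) := fun v hv => by
    conv_rhs => rw [← filter_piecewise hRN hU hq hp]
    simp [hv]
  rw [prod_union hRN, union_sdiff_of_subset hU]
  congr 1
  · refine prod_congr rfl fun w hw => ?_
    congr 2
    ext v
    simp only [mem_filter]
    constructor
    · rintro ⟨hv, rfl⟩
      have hvU := (hfil v hv).mp hw
      exact ⟨hvU, (piecewise_eq_of_mem _ _ _ hvU).symm⟩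
    · rintro ⟨hv, rfl⟩
      exact ⟨hU hv, piecewise_eq_of_mem _ _ _ hv⟩
  · refine prod_congr rfl fun w hw => ?_
    congr 2
    ext v
    simp only [mem_filter, mem_sdiff]
    constructor
    · rintro ⟨hv, rfl⟩
      have hvU : v ∉ U := fun h => disjoint_left.mp hRN ((hfil v hv).mpr h) hw
      exact ⟨⟨hv, hvU⟩, (piecewise_eq_of_notMem _ _ _ hvU).symm⟩
    · rintro ⟨⟨hv, hvU⟩, rfl⟩
      exact ⟨hv, piecewise_eq_of_notMem _ _ _ hvU⟩

/-- A forest with set of roots `R` is determined by the set `U` of children of its roots, the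
parents of the elements of `U`, and a forest with set of roots `U`. -/
theorem forestWeight_eq_sum_powerset (f : ℕ → A) {R N : Finset V} (hRN : Disjoint R N) :
    forestWeight f R N = ∑ U ∈ N.powerset,
      (∑ q ∈ attachments U R, ∏ w ∈ R, f #{v ∈ U | q v = w}) * forestWeight f U (N \ U) := by
  rw [forestWeight, ← sum_fiberwise_of_maps_to (t := N.powerset)
    (g := fun p => ({v ∈ N | p v ∈ R} : Finset V))
    (fun p _ => mem_powerset.mpr (filter_subset _ _))]
  refine sum_congr rfl fun U hU => ?_
  rw [mem_powerset] at hU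
  rw [forestWeight, sum_mul_sum, ← sum_product']
  symm
  refine sum_nbij' (fun x => U.piecewise x.1 x.2)
    (fun p => (U.piecewise p id, U.piecewise id p)) ?_ ?_ ?_ ?_ ?_
  · rintro ⟨q, p⟩ h
    obtain ⟨hq, hp⟩ := mem_product.mp h
    exact mem_filter.mpr ⟨piecewise_mem_forests hU hq hp, filter_piecewise hRN hU hq hp⟩
  · intro p hp
    obtain ⟨hp', rfl⟩ := mem_filter.mp hp
    refine mem_product.mpr ⟨mem_attachments.mpr ⟨fun v hv => ?_, fun v hv => ?_⟩,
      restrict_mem_forests hRN hp'⟩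
    · simp only [piecewise_eq_of_mem _ _ _ hv]
      exact (mem_filter.mp hv).2
    · exact piecewise_eq_of_notMem _ _ _ hv
  · rintro ⟨q, p⟩ h
    obtain ⟨hq, hp⟩ := mem_product.mp h
    have hq' : ∀ v ∉ U, q v = v := (mem_attachments.mp hq).2
    have hp' : ∀ v ∉ N \ U, p v = v := (mem_forests.mp hp).1.2
    refine Prod.ext ?_ ?_
    · ext v
      by_cases hv : v ∈ U
      · simp [hv]
      · simp [hv, hq' v hv]
    · ext v
      by_cases hv : v ∈ U
      · simp [hv, hp' v (fun h => (mem_sdiff.mp h).2 hv)]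
      · simp [hv]
  · intro p hp
    exact piecewise_id_piecewise p
  · rintro ⟨q, p⟩ h
    obtain ⟨hq, hp⟩ := mem_product.mp h
    exact (prod_piecewise_children f hRN hU hq hp).symm

/-- The weighted enumeration of rooted forests with prescribed roots. -/
theorem forestWeight_egfCoeff [Algebra ℚ A] (F : PowerSeries A) {R N : Finset V}
    (hRN : Disjoint R N) :
    forestWeight (egfCoeff F) R N = (#N).factorial • forestCoeff F #R #N := by
  induction hn : #N using Nat.strong_induction_on generalizing R N with
  | _ n ih =>
  rcases R.eq_empty_or_nonempty with rfl | hR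
  · rw [card_empty, forestCoeff_zero_left]
    rcases N.eq_empty_or_nonempty with rfl | hN
    · subst hn
      simp [forestWeight, forests_empty_right]
    · have : n ≠ 0 := by rw [← hn]; exact hN.card_pos.ne'
      simp [forestWeight, forests_empty_left_of_nonempty hN, this]
  · have hterm : ∀ U ∈ N.powerset,
        (∑ q ∈ attachments U R, ∏ w ∈ R, egfCoeff F #{v ∈ U | q v = w}) *
          forestWeight (egfCoeff F) U (N \ U) =
        egfCoeff (F ^ #R) #U * ((n - #U).factorial • forestCoeff F #U (n - #U)) := by
      intro U hU
      rw [mem_powerset] at hU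
      have hcard : #(N \ U) = n - #U := by rw [card_sdiff_of_subset hU, hn]
      rw [sum_attachments U R (fun _ => F), prod_const]
      congr 1
      -- For `U = ∅` the number of non-roots does not decrease, so the induction hypothesis is
      -- unavailable; the value is computed directly.
      rcases U.eq_empty_or_nonempty with rfl | hU'
      · rw [sdiff_empty, card_empty, forestCoeff_zero_left]
        rcases N.eq_empty_or_nonempty with rfl | hN
        · subst hn
          simp [forestWeight, forests_empty_right]
        · have : n ≠ 0 := by rw [← hn]; exact hN.card_pos.ne'
          simp [forestWeight, forests_empty_left_of_nonempty hN, this]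
      · have hpos := hU'.card_pos
        have hle := card_le_card hU
        exact ih (n - #U) (by omega) disjoint_sdiff hcard
    rw [forestWeight_eq_sum_powerset _ hRN, sum_congr rfl hterm,
      sum_powerset_apply_card
        (fun k => egfCoeff (F ^ #R) k * ((n - k).factorial • forestCoeff F k (n - k))), hn,
      forestCoeff_eq_sum, Nat.sum_antidiagonal_eq_sum_range_succ
        (fun k l => PowerSeries.coeff k (F ^ #R) * forestCoeff F k l), smul_sum]
    refine sum_congr rfl fun k hk => ?_
    have hkn : k ≤ n := by
      rw [mem_range] at hk
      omega
    rw [egfCoeff, smul_mul_smul_comm, smul_smul, ← mul_assoc,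
      Nat.choose_mul_factorial_mul_factorial hkn]

end Forests

/-! ### Rooted trees and the implicit equation. -/

section Trees

theorem mem_forests_singleton {n : ℕ} {r : Fin n} {p : Fin n → Fin n} :
    p ∈ forests {r} (univ.erase r) ↔ p r = r ∧ ∀ v, ∃ k : ℕ, p^[k] v = r := by
  rw [mem_forests]
  simp only [mem_erase, mem_univ, and_true, mem_singleton, mem_union, not_not]
  constructor
  · rintro ⟨⟨-, h2⟩, h3⟩
    refine ⟨h2 r rfl, fun v => ?_⟩
    rcases eq_or_ne v r with rfl | hv
    · exact ⟨0, rfl⟩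
    · exact h3 v hv
  · rintro ⟨h1, h2⟩
    exact ⟨⟨fun v _ => em _, fun v hv => hv ▸ h1⟩, fun v _ => h2 v⟩

variable {A : Type*} [CommRing A]

/-- A rooted tree is a forest with a single root. Erasing the root from the non-root set keeps its
self-loop from counting as a child. -/
theorem inventory_eq_sum_forestWeight (F : PowerSeries A) (n : ℕ) :
    inventory F n = ∑ r : Fin n, forestWeight (egfCoeff F) {r} (univ.erase r) := by
  classical
  simp only [forestWeight]
  rw [sum_sigma', inventory]
  refine sum_bij' (fun T _ => ⟨T.root, T.parent⟩)
    (fun x hx => ⟨x.1, x.2, (mem_forests_singleton.mp (mem_sigma.mp hx).2).1,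
      (mem_forests_singleton.mp (mem_sigma.mp hx).2).2⟩) ?_ ?_ ?_ ?_ ?_
  · intro T _
    exact mem_sigma.mpr ⟨mem_univ _, mem_forests_singleton.mpr ⟨T.parent_root, T.reaches_root⟩⟩
  · intro x hx
    exact mem_univ _
  · intro T _
    rfl
  · intro x hx
    rfl
  · intro T _
    have huniv : ({T.root} : Finset (Fin n)) ∪ univ.erase T.root = univ := by
      ext v
      simp
    simp only [huniv]
    refine prod_congr rfl fun w _ => ?_
    congr 1
    rw [← Set.ncard_coe_finset]
    congr 1
    ext v
    simp [RootedTree.fiber]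

theorem inventory_zero (F : PowerSeries A) : inventory F 0 = 0 := by
  rw [inventory_eq_sum_forestWeight]
  simp

variable [Algebra ℚ A]

theorem inventory_eq_smul_forestCoeff (F : PowerSeries A) (n : ℕ) :
    inventory F (n + 1) = (n + 1).factorial • forestCoeff F 1 n := by
  rw [inventory_eq_sum_forestWeight]
  have : ∀ r : Fin (n + 1), forestWeight (egfCoeff F) {r} (univ.erase r) =
      n.factorial • forestCoeff F 1 n := fun r => by
    rw [forestWeight_egfCoeff F (by simp)]
    simp
  rw [sum_congr rfl fun r _ => this r, sum_const, card_univ, Fintype.card_fin, smul_smul,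
    Nat.factorial_succ]

/-- The inventory of enriched trees in terms of the powers of the series. -/
theorem inventory_succ (F : PowerSeries A) (n : ℕ) :
    inventory F (n + 1) = egfCoeff (F ^ (n + 1)) n := by
  rw [inventory_eq_smul_forestCoeff, forestCoeff, if_neg one_ne_zero, egfCoeff,
    ← Nat.cast_smul_eq_nsmul ℚ, ← Nat.cast_smul_eq_nsmul ℚ, smul_smul]
  -- What remains is (n+1)! · 1/(n+1) = n!.
  congr 1
  rw [Nat.factorial_succ]
  have : (n : ℚ) + 1 ≠ 0 := by positivity
  push_cast
  field_simp

theorem coeff_succ_treeSeries (F : PowerSeries A) (n : ℕ) :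
    PowerSeries.coeff (n + 1) (treeSeries F) = forestCoeff F 1 n := by
  rw [treeSeries, PowerSeries.coeff_mk, inventory_eq_smul_forestCoeff,
    ← Nat.cast_smul_eq_nsmul ℚ, inv_smul_smul₀ (by exact_mod_cast Nat.factorial_ne_zero _)]

/-- By Lagrange inversion, [tⁿ⁺¹]B = [tⁿ]F(B) is a number depending on `F` alone, and it is the one
counting trees. -/
theorem eq_treeSeries_of_eq_X_mul_subst {F B : PowerSeries A}
    (h : B = PowerSeries.X * PowerSeries.subst B F) : B = treeSeries F := by
  ext n
  cases n with
  | zero =>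
    rw [PowerSeries.coeff_zero_eq_constantCoeff_apply, constantCoeff_eq_zero_of_eq_X_mul h,
      treeSeries, PowerSeries.coeff_mk, inventory_zero, smul_zero]
  | succ n =>
    rw [coeff_succ_treeSeries, ← coeff_subst_pow_eq_forestCoeff h, pow_one]
    conv_lhs => rw [h]
    rw [PowerSeries.coeff_succ_X_mul]

/-- The tree series is the unique solution of the implicit equation `B(t) = t F(B(t))`. -/
theorem eq_X_mul_subst_iff_eq_treeSeries (F B : PowerSeries A) :
    B = PowerSeries.X * PowerSeries.subst B F ↔ B = treeSeries F := by
  refine ⟨eq_treeSeries_of_eq_X_mul_subst, ?_⟩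
  rintro rfl
  obtain ⟨C, hC⟩ := exists_eq_X_mul_subst F
  rwa [eq_treeSeries_of_eq_X_mul_subst hC] at hC

end Trees

/-! ### The exponential of a derivation as a substitution. -/

section Derivations

/-- The iterated Leibniz rule. -/
theorem iterate_derivation_mul {k B : Type*} [CommRing k] [CommRing B] [Algebra k B]
    (D : Derivation k B B) (n : ℕ) (f g : B) :
    D^[n] (f * g) = ∑ p ∈ antidiagonal n, (n.choose p.1 : B) * (D^[p.1] f * D^[p.2] g) := by
  induction n with
  | zero => simp
  | succ n ih =>
    rw [Function.iterate_succ_apply', ih, map_sum,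
      sum_antidiagonal_choose_succ_mul (fun i j => D^[i] f * D^[j] g), ← sum_add_distrib]
    refine sum_congr rfl ?_
    rintro ⟨i, j⟩ hij
    rw [HasAntidiagonal.mem_antidiagonal] at hij
    simp only at hij ⊢
    have hc : n.choose i = n.choose j := by
      rw [← hij]
      exact Nat.choose_symm_add
    rw [Derivation.leibniz, Derivation.map_natCast, Derivation.leibniz, ← hc]
    simp only [smul_eq_mul, Function.iterate_succ_apply', mul_zero, add_zero]
    ring

/-- An algebra homomorphism between rings of power series, each of whose coefficients depends on
only finitely many coefficients of the argument, is a substitution. -/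
theorem algHom_eq_subst {k σ τ : Type*} [CommRing k] {a : σ → MvPowerSeries τ k}
    (ha : MvPowerSeries.HasSubst a) (ψ : MvPowerSeries σ k →ₐ[k] MvPowerSeries τ k)
    (hX : ∀ s, ψ (MvPowerSeries.X s) = a s)
    (hψ : ∀ e, ∃ s : Finset (σ →₀ ℕ), ∀ f : MvPowerSeries σ k,
      (∀ d ∈ s, MvPowerSeries.coeff d f = 0) → MvPowerSeries.coeff e (ψ f) = 0)
    (f : MvPowerSeries σ k) : ψ f = MvPowerSeries.subst a f := by
  classical
  ext e
  obtain ⟨s, hs⟩ := hψ e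
  -- With all coefficients of `u` equal to 1, the finite set `t` below catches every exponent whose
  -- substituted monomial contributes to the coefficient at `e`.
  obtain ⟨u, hu⟩ : ∃ u : MvPowerSeries σ k, ∀ d, MvPowerSeries.coeff d u = 1 :=
    ⟨fun _ => 1, fun _ => rfl⟩
  set t : Finset (σ →₀ ℕ) := (MvPowerSeries.coeff_subst_finite ha u e).toFinset with ht
  -- Truncating `f` to `s ∪ t` changes neither side at `e`, and on polynomials the two homomorphisms
  -- agree because they agree on the variables.
  set p : MvPolynomial σ k := ∑ d ∈ s ∪ t, MvPolynomial.monomial d (MvPowerSeries.coeff d f)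
    with hp
  have hcoeff : ∀ d ∈ s ∪ t, MvPowerSeries.coeff d (f - (p : MvPowerSeries σ k)) = 0 := by
    intro d hd
    rw [map_sub, MvPolynomial.coeff_coe, hp, MvPolynomial.coeff_sum]
    simp [MvPolynomial.coeff_monomial, hd, -mem_union]
  have hpoly : ψ (p : MvPowerSeries σ k) = MvPowerSeries.subst a (p : MvPowerSeries σ k) := by
    have h : ψ.comp (MvPolynomial.coeToMvPowerSeries.algHom k) =
        (MvPowerSeries.substAlgHom ha).comp (MvPolynomial.coeToMvPowerSeries.algHom k) := by
      refine MvPolynomial.algHom_ext fun i => ?_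
      simp [hX, MvPowerSeries.subst_X ha]
    have h' := DFunLike.congr_fun h p
    simpa [MvPowerSeries.coe_substAlgHom ha] using h'
  have h1 : MvPowerSeries.coeff e (ψ f) = MvPowerSeries.coeff e (ψ (p : MvPowerSeries σ k)) := by
    rw [← sub_eq_zero, ← map_sub, ← map_sub]
    exact hs _ fun d hd => hcoeff d (mem_union_left _ hd)
  have h2 : MvPowerSeries.coeff e (MvPowerSeries.subst a f) =
      MvPowerSeries.coeff e (MvPowerSeries.subst a (p : MvPowerSeries σ k)) := by
    rw [← sub_eq_zero, ← map_sub, ← MvPowerSeries.subst_sub ha, MvPowerSeries.coeff_subst ha]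
    refine finsum_eq_zero_of_forall_eq_zero fun d => ?_
    by_cases hd : d ∈ t
    · rw [hcoeff d (mem_union_right _ hd), zero_smul]
    · have hd' : MvPowerSeries.coeff e (d.prod fun s n => a s ^ n) = 0 := by
        by_contra h
        exact hd (by simpa [ht, hu] using h)
      rw [hd', smul_zero]
  rw [h1, h2, hpoly]

variable {X : Type*} {S : Set X} {φ : S → MvPowerSeries X ℂ}

/-- Only finitely many exponents lie below `k`. One finite index set, independent of the argument of
`derivOp φ`, thus suffices for all coefficients up to `k`. -/
theorem IsSummable.exists_finset (hφ : IsSummable φ) (k : X →₀ ℕ) :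
    ∃ T : Finset S, ∀ x ∉ T, ∀ j ≤ k, MvPowerSeries.coeff j (φ x) = 0 := by
  classical
  have hfin : (⋃ j ∈ Set.Iic k, {x | MvPowerSeries.coeff j (φ x) ≠ 0}).Finite :=
    (Set.finite_Iic k).biUnion fun j _ => hφ j
  refine ⟨hfin.toFinset, fun x hx j hj => ?_⟩
  by_contra h
  exact hx (hfin.mem_toFinset.mpr (Set.mem_biUnion (Set.mem_Iic.mpr hj) h))

theorem coeff_derivOp {k : X →₀ ℕ} {T : Finset S}
    (hT : ∀ x ∉ T, ∀ j ≤ k, MvPowerSeries.coeff j (φ x) = 0) (H : MvPowerSeries X ℂ) :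
    MvPowerSeries.coeff k (derivOp φ H) =
      ∑ x ∈ T, MvPowerSeries.coeff k (φ x * MvPowerSeries.pderiv ℂ (x : X) H) := by
  classical
  change ∑ᶠ x : S, MvPowerSeries.coeff k (φ x * MvPowerSeries.pderiv ℂ (x : X) H) = _
  refine finsum_eq_sum_of_support_subset _ fun x hx => ?_
  by_contra h
  refine hx ?_
  simp only
  rw [MvPowerSeries.coeff_mul]
  refine sum_eq_zero fun p hp => ?_
  rw [hT x h p.1 (by rw [← HasAntidiagonal.mem_antidiagonal.mp hp]; exact self_le_add_right _ _),
    zero_mul]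

/-- `𝒟^φ` as a derivation of the ring of power series. -/
def derivation (hφ : IsSummable φ) : Derivation ℂ (MvPowerSeries X ℂ) (MvPowerSeries X ℂ) :=
  Derivation.mk'
    { toFun := derivOp φ
      map_add' := fun f g => by
        ext k
        obtain ⟨T, hT⟩ := hφ.exists_finset k
        simp only [map_add, coeff_derivOp hT, mul_add, sum_add_distrib]
      map_smul' := fun c f => by
        ext k
        obtain ⟨T, hT⟩ := hφ.exists_finset k
        rw [RingHom.id_apply, MvPowerSeries.coeff_smul, coeff_derivOp hT, coeff_derivOp hT, mul_sum]
        refine sum_congr rfl fun x _ => ?_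
        rw [(MvPowerSeries.pderiv ℂ (x : X)).map_smul, mul_smul_comm, MvPowerSeries.coeff_smul] }
    fun f g => by
      classical
      ext k
      obtain ⟨T, hT⟩ := hφ.exists_finset k
      -- The coefficient at `k` of a product involves only coefficients of the factors at exponents
      -- at most `k`, so the same `T` serves throughout.
      have key : ∀ a b : MvPowerSeries X ℂ, MvPowerSeries.coeff k (a * derivOp φ b) =
          MvPowerSeries.coeff k (a * ∑ x ∈ T, φ x * MvPowerSeries.pderiv ℂ (x : X) b) := by
        intro a b
        rw [MvPowerSeries.coeff_mul, MvPowerSeries.coeff_mul]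
        refine sum_congr rfl fun p hp => ?_
        have hle : p.2 ≤ k := by
          rw [← HasAntidiagonal.mem_antidiagonal.mp hp]
          exact self_le_add_left _ _
        rw [coeff_derivOp (fun x hx j hj => hT x hx j (hj.trans hle)), map_sum]
      simp only [LinearMap.coe_mk, AddHom.coe_mk, smul_eq_mul, map_add, key]
      rw [coeff_derivOp hT, ← map_add, ← map_sum, mul_sum, mul_sum, ← sum_add_distrib]
      congr 1
      refine sum_congr rfl fun x _ => ?_
      rw [Derivation.leibniz, smul_eq_mul, smul_eq_mul]
      ring

theorem coe_derivation (hφ : IsSummable φ) : ⇑(derivation hφ) = derivOp φ := rfl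

theorem derivOp_finitely_determined (hφ : IsSummable φ) (k : X →₀ ℕ) :
    ∃ s : Finset (X →₀ ℕ), ∀ f : MvPowerSeries X ℂ,
      (∀ d ∈ s, MvPowerSeries.coeff d f = 0) → MvPowerSeries.coeff k (derivOp φ f) = 0 := by
  classical
  obtain ⟨T, hT⟩ := hφ.exists_finset k
  refine ⟨(T ×ˢ antidiagonal k).image fun x => x.2.2 + Finsupp.single (x.1 : X) 1,
    fun f hf => ?_⟩
  rw [coeff_derivOp hT]
  refine sum_eq_zero fun x hx => ?_
  rw [MvPowerSeries.coeff_mul]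
  refine sum_eq_zero fun p hp => ?_
  rw [MvPowerSeries.coeff_pderiv,
    hf _ (mem_image.mpr ⟨(x, p), mem_product.mpr ⟨hx, hp⟩, rfl⟩), zero_mul, mul_zero]

theorem iterate_derivOp_finitely_determined (hφ : IsSummable φ) (n : ℕ) (k : X →₀ ℕ) :
    ∃ s : Finset (X →₀ ℕ), ∀ f : MvPowerSeries X ℂ,
      (∀ d ∈ s, MvPowerSeries.coeff d f = 0) → MvPowerSeries.coeff k ((derivOp φ)^[n] f) = 0 := by
  classical
  induction n with
  | zero => exact ⟨{k}, fun f hf => hf k (mem_singleton_self k)⟩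
  | succ n ih =>
    obtain ⟨s, hs⟩ := ih
    choose t ht using derivOp_finitely_determined hφ
    refine ⟨s.biUnion t, fun f hf => ?_⟩
    rw [Function.iterate_succ_apply]
    exact hs _ fun d hd => ht d f fun d' hd' => hf d' (mem_biUnion.mpr ⟨d, hd, hd'⟩)

/-- The derivatives of the variables form a summable family. -/
theorem isSummable_iterate_derivOp_X (hφ : IsSummable φ) (n : ℕ) :
    IsSummable fun x : X => (derivOp φ)^[n] (MvPowerSeries.X x) := by
  classical
  intro k
  obtain ⟨s, hs⟩ := iterate_derivOp_finitely_determined hφ n k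
  -- The series of the variable `x` has a single nonzero coefficient, at `single x 1`, and only
  -- finitely many of these exponents lie in `s`.
  refine (s.finite_toSet.preimage (f := fun x : X => Finsupp.single x 1)
    (fun x _ y _ h => Finsupp.single_left_injective one_ne_zero h)).subset fun x hx => ?_
  by_contra h
  refine hx (hs _ fun d hd => ?_)
  rw [MvPowerSeries.coeff_X, if_neg]
  rintro rfl
  exact h hd

theorem iterate_succ_derivOp_algebraMap (hφ : IsSummable φ) (n : ℕ) (c : ℂ) :
    (derivOp φ)^[n + 1] (algebraMap ℂ (MvPowerSeries X ℂ) c) = 0 := by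
  rw [← coe_derivation hφ, Function.iterate_succ_apply, Derivation.map_algebraMap,
    iterate_map_zero]

theorem expDerivOp_algebraMap (hφ : IsSummable φ) (c : ℂ) :
    expDerivOp φ (algebraMap ℂ (MvPowerSeries X ℂ) c) =
      algebraMap ℂ (PowerSeries (MvPowerSeries X ℂ)) c := by
  ext1 n
  rw [PowerSeries.algebraMap_apply, PowerSeries.coeff_C, expDerivOp, PowerSeries.coeff_mk]
  cases n with
  | zero => simp
  | succ n => rw [iterate_succ_derivOp_algebraMap hφ, smul_zero, if_neg n.succ_ne_zero]

theorem expDerivOp_add (hφ : IsSummable φ) (f g : MvPowerSeries X ℂ) :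
    expDerivOp φ (f + g) = expDerivOp φ f + expDerivOp φ g := by
  ext1 n
  simp only [expDerivOp, PowerSeries.coeff_mk, map_add, ← coe_derivation hφ, iterate_map_add,
    smul_add]

theorem expDerivOp_mul (hφ : IsSummable φ) (f g : MvPowerSeries X ℂ) :
    expDerivOp φ (f * g) = expDerivOp φ f * expDerivOp φ g := by
  ext1 n
  simp only [expDerivOp, PowerSeries.coeff_mk, PowerSeries.coeff_mul, ← coe_derivation hφ]
  rw [iterate_derivation_mul, smul_sum]
  refine sum_congr rfl ?_
  rintro ⟨i, j⟩ hij
  rw [HasAntidiagonal.mem_antidiagonal] at hij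
  simp only at hij ⊢
  subst hij
  rw [smul_mul_smul_comm, ← nsmul_eq_mul, ← Nat.cast_smul_eq_nsmul ℂ, smul_smul]
  congr 1
  rw [Nat.cast_add_choose]
  have h1 : ((i + j).factorial : ℂ) ≠ 0 := by exact_mod_cast Nat.factorial_ne_zero _
  have h2 : (i.factorial : ℂ) ≠ 0 := by exact_mod_cast Nat.factorial_ne_zero _
  have h3 : (j.factorial : ℂ) ≠ 0 := by exact_mod_cast Nat.factorial_ne_zero _
  field_simp

/-- `e^{t𝒟^φ}` is a homomorphism of algebras. -/
def expAlgHom (hφ : IsSummable φ) :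
    MvPowerSeries X ℂ →ₐ[ℂ] PowerSeries (MvPowerSeries X ℂ) where
  toFun := expDerivOp φ
  map_one' := by simpa using expDerivOp_algebraMap hφ 1
  map_mul' := expDerivOp_mul hφ
  map_zero' := by simpa using expDerivOp_algebraMap hφ 0
  map_add' := expDerivOp_add hφ
  commutes' := expDerivOp_algebraMap hφ

theorem expAlgHom_apply (hφ : IsSummable φ) (H : MvPowerSeries X ℂ) :
    expAlgHom hφ H = expDerivOp φ H := rfl

theorem coeff_optionEquivLeft_symm (p : PowerSeries (MvPowerSeries X ℂ)) (e : Option X →₀ ℕ) :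
    MvPowerSeries.coeff e ((MvPowerSeries.optionEquivLeft X ℂ).symm p) =
      MvPowerSeries.coeff e.some (PowerSeries.coeff (e none) p) := by
  have h := MvPowerSeries.coeff_coeff_optionEquivLeft
    ((MvPowerSeries.optionEquivLeft X ℂ).symm p) (e none) e.some
  rw [AlgEquiv.apply_symm_apply] at h
  rw [h]
  congr 2
  simp

theorem coeff_symm_expDerivOp (H : MvPowerSeries X ℂ) (e : Option X →₀ ℕ) :
    MvPowerSeries.coeff e ((MvPowerSeries.optionEquivLeft X ℂ).symm (expDerivOp φ H)) =
      ((e none).factorial : ℂ)⁻¹ * MvPowerSeries.coeff e.some ((derivOp φ)^[e none] H) := by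
  rw [coeff_optionEquivLeft_symm, expDerivOp, PowerSeries.coeff_mk, map_smul, smul_eq_mul]

/-- A monomial in X and t fixes the power n of t, so summability over x is only needed for the
single family 𝒟ⁿx. -/
theorem hasSubst_flowMv (hφ : IsSummable φ) : MvPowerSeries.HasSubst (flowMv φ) where
  const_coeff x := by
    have h : MvPowerSeries.constantCoeff (flowMv φ x) = 0 := by
      rw [← MvPowerSeries.coeff_zero_eq_constantCoeff_apply, flowMv, flow, coeff_symm_expDerivOp]
      simp
    rw [h]
    exact IsNilpotent.zero
  coeff_zero e := by
    refine (isSummable_iterate_derivOp_X hφ (e none) e.some).subset fun x hx h => hx ?_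
    rw [flowMv, flow, coeff_symm_expDerivOp, h, mul_zero]

/-- The substitution of the series `F_x(t)` is the operator `e^{t𝒟^φ}`. -/
theorem substFlow_eq_expDerivOp (hφ : IsSummable φ) (H : MvPowerSeries X ℂ) :
    substFlow φ H = expDerivOp φ H := by
  have h := algHom_eq_subst (hasSubst_flowMv hφ)
    ((MvPowerSeries.optionEquivLeft X ℂ).symm.toAlgHom.comp (expAlgHom hφ)) (fun _ => rfl)
    (fun e => by
      obtain ⟨s, hs⟩ := iterate_derivOp_finitely_determined hφ (e none) e.some
      refine ⟨s, fun f hf => ?_⟩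
      change MvPowerSeries.coeff e
        ((MvPowerSeries.optionEquivLeft X ℂ).symm (expDerivOp φ f)) = 0
      rw [coeff_symm_expDerivOp, hs f hf, mul_zero]) H
  rw [substFlow, ← h]
  exact AlgEquiv.apply_symm_apply _ _

/-- Multiplicativity moves the power in `inventory_succ` inside the exponential: (e^{t𝒟}H)ⁿ =
e^{t𝒟}(Hⁿ). -/
theorem inventory_expDerivOp (hφ : IsSummable φ) (H : MvPowerSeries X ℂ) {n : ℕ} (hn : 1 ≤ n) :
    inventory (expDerivOp φ H) n = (derivOp φ)^[n - 1] (H ^ n) := by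
  obtain ⟨m, rfl⟩ := Nat.exists_eq_add_of_le' hn
  rw [inventory_succ, ← expAlgHom_apply hφ, ← map_pow, expAlgHom_apply, egfCoeff, expDerivOp,
    PowerSeries.coeff_mk, ← Nat.cast_smul_eq_nsmul ℂ,
    smul_inv_smul₀ (by exact_mod_cast Nat.factorial_ne_zero _), Nat.add_sub_cancel]

end Derivations

end EnrichedTree

end

theorem mainTheorem7 {X : Type*} (S : Set X) (φ : S → MvPowerSeries X ℂ)
    (hφ : EnrichedTree.IsSummable φ) :
    -- the substitution of the family `F_x(t)` in series in the variables `X` is well defined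
    MvPowerSeries.HasSubst (EnrichedTree.flowMv φ) ∧
    (∀ H : MvPowerSeries X ℂ,
      -- the tree series is the solution of the implicit equation `A(t) = t F(A(t))`
      (∀ A : PowerSeries (MvPowerSeries X ℂ),
        A = PowerSeries.X * PowerSeries.subst A (EnrichedTree.substFlow φ H) ↔
          A = EnrichedTree.treeSeries (EnrichedTree.substFlow φ H)) ∧
      ∀ n : ℕ, 1 ≤ n →
        EnrichedTree.inventory (EnrichedTree.substFlow φ H) n =
          (EnrichedTree.derivOp φ)^[n - 1] (H ^ n)) ∧
    (∀ x : X,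
      (∀ A : PowerSeries (MvPowerSeries X ℂ),
        A = PowerSeries.X * PowerSeries.subst A (EnrichedTree.flow φ x) ↔
          A = EnrichedTree.treeSeries (EnrichedTree.flow φ x)) ∧
      ∀ n : ℕ, 1 ≤ n →
        EnrichedTree.inventory (EnrichedTree.flow φ x) n =
          (EnrichedTree.derivOp φ)^[n - 1] (MvPowerSeries.X x ^ n)) :=
  ⟨EnrichedTree.hasSubst_flowMv hφ,
    fun H => ⟨fun A => EnrichedTree.eq_X_mul_subst_iff_eq_treeSeries _ A, fun n hn => by
      rw [EnrichedTree.substFlow_eq_expDerivOp hφ, EnrichedTree.inventory_expDerivOp hφ H hn]⟩,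
    -- F_x(t) is by definition the exponential applied to the variable, so no substitution
    -- intervenes.
    fun x => ⟨fun A => EnrichedTree.eq_X_mul_subst_iff_eq_treeSeries _ A, fun n hn =>
      EnrichedTree.inventory_expDerivOp hφ _ hn⟩⟩
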